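/- A \emph{$*$-category} is a category with a chosen morphism $f^*\colon Y\to X$ for each $f\colon X\to Y$, such that $1^*=1$, $(gf)^*=f^*g^*$ and $f^{**}=f$. A morphism $f$ is \emph{isometric} if $f^*f=1$ and \emph{coisometric} if $ff^*=1$. In a $*$-category with a zero object, a binary product $X_1\xleftarrow{r_1}X\xrightarrow{r_2}X_2$ is \emph{orthonormal} if $r_1,r_2$ are coisometric and $r_1r_2^*=0$; it is then a biproduct. A \emph{pre-Hilbert $*$-category} is a $*$-category with a zero object, binary orthonormal products and isometric kernels, in which every diagonal $\langle 1,1\rangle\colon X\to X\oplus X$ is a kernel. Such a category has a canonical addition of parallel morphisms (induced by its biproducts), and its Hermitian endomorphisms of an object $A$ are ordered by $a\le b$ if and only if $b-a=h^*h$ (that is, $b = a+h^*h$) for some morphism $h$ with domain $A$. A morphism $f$ is a \emph{contraction} if $f^*f\le 1$. Let $J$ be a directed set (a non-empty preordered set in which every two elements have an upper bound) and let $(f_{j\le k}\colon X_k\to X_j)_{j\le k\in J}$ be a codirected diagram of contractions, so that $f_{j\le j}=1$ and $f_{j\le k}f_{k\le l}=f_{j\le l}$. A cone $(g_j\colon Y\to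 X_j)_{j\in J}$ on it (so that $f_{j\le k}g_k=g_j$) is an \emph{$\ell^2$-cone} if the family $(g_j^*g_j)_{j\in J}$ is bounded above. An \emph{$\ell^2$-limit} of the diagram is an $\ell^2$-cone $(f_j\colon X\to X_j)_{j\in J}$ such that for every $\ell^2$-cone $(g_j\colon Y\to X_j)_{j\in J}$ there is a unique morphism $g\colon Y\to X$ with $f_jg=g_j$ for all $j\in J$, and this $g$ satisfies $g^*g=\sup_{j\in J}g_j^*g_j$. A \emph{Hilbert $*$-category} is a pre-Hilbert $*$-category that has $\ell^2$-limits of all codirected diagrams of contractions. A pre-Hilbert $*$-category is \emph{Douglian} if for all morphisms $f\colon A\to X$ and $g\colon A\to Y$ with $f^*f=g^*g$ there is a morphism $h\colon X\to Y$ with $g=hf$. \textbf{Theorem.} Every Hilbert $*$-category is Douglian. -/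

import Mathlib

open CategoryTheory CategoryTheory.Limits Opposite

universe w v u

/-- A `*`-category: a category with a contravariant, identity-on-objects involution `f ↦ f*`
on morphisms. Composition is in diagrammatic order: `f ≫ g` is `g f`. -/
class StarCategory (C : Type u) [Category.{v} C] where
  /-- the involution `f ↦ f*` -/
  adj : ∀ {X Y : C}, (X ⟶ Y) → (Y ⟶ X)
  adj_id : ∀ X : C, adj (𝟙 X) = 𝟙 X
  adj_comp : ∀ {X Y Z : C} (f : X ⟶ Y) (g : Y ⟶ Z), adj (f ≫ g) = adj g ≫ adj f
  adj_adj : ∀ {X Y : C} (f : X ⟶ Y), adj (adj f) = f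

namespace StarCategory

section Basic

variable {C : Type u} [Category.{v} C] [StarCategory C]

/-- `f` is isometric if `f* f = 1`. -/
def IsIsometry {X Y : C} (f : X ⟶ Y) : Prop := f ≫ adj f = 𝟙 X

/-- `f` is coisometric if `f f* = 1`. -/
def IsCoisometry {X Y : C} (f : X ⟶ Y) : Prop := adj f ≫ f = 𝟙 Y

/-- The endomorphism `f* f` of the domain of `f`. -/
def sq {X Y : C} (f : X ⟶ Y) : X ⟶ X := f ≫ adj f

/-- A binary product `X₁ ← X → X₂` is orthonormal if its projections `r₁`, `r₂` are coisometries
and `r₁ r₂* = 0`. -/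
structure IsOrthonormalProduct [HasZeroMorphisms C] {X₁ X₂ X : C} (r₁ : X ⟶ X₁) (r₂ : X ⟶ X₂) :
    Prop where
  isProduct : Nonempty (IsLimit (BinaryFan.mk r₁ r₂))
  coisometry₁ : IsCoisometry r₁
  coisometry₂ : IsCoisometry r₂
  orthogonal : adj r₂ ≫ r₁ = 0

theorem IsOrthonormalProduct.hasBinaryBiproduct [HasZeroMorphisms C] {X₁ X₂ X : C}
    {r₁ : X ⟶ X₁} {r₂ : X ⟶ X₂} (h : IsOrthonormalProduct r₁ r₂) : HasBinaryBiproduct X₁ X₂ := by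
  obtain ⟨⟨hl⟩, h₁, h₂, h₀⟩ := h
  have adj_inj : ∀ {A B : C} {f g : A ⟶ B}, adj f = adj g → f = g := fun {A B f g} e => by
    rw [← adj_adj f, e, adj_adj]
  have h₀' : adj r₁ ≫ r₂ = 0 := by
    have adj_zero : ∀ A B : C, adj (0 : A ⟶ B) = 0 := fun A B => by
      have e : (0 : A ⟶ B) = (0 : A ⟶ B) ≫ adj (0 : A ⟶ B) ≫ (0 : A ⟶ B) := by simp
      rw [e, adj_comp, adj_comp, adj_adj]; simp
    have e := congrArg adj h₀
    rwa [adj_comp, adj_adj, adj_zero] at e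
  refine HasBinaryBiproduct.mk
    { bicone :=
        { pt := X, fst := r₁, snd := r₂, inl := adj r₁, inr := adj r₂
          inl_fst := h₁, inl_snd := h₀', inr_fst := h₀, inr_snd := h₂ }
      isBilimit :=
        { isLimit := hl
          isColimit := BinaryCofan.isColimitMk
            (fun s => adj (BinaryFan.IsLimit.lift hl (adj s.inl) (adj s.inr)))
            (fun s => ?_) (fun s => ?_) (fun s m e₁ e₂ => ?_) } }
  · rw [← adj_comp]
    exact (congrArg adj (BinaryFan.IsLimit.lift_fst hl (adj s.inl) (adj s.inr))).trans (adj_adj _)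
  · rw [← adj_comp]
    exact (congrArg adj (BinaryFan.IsLimit.lift_snd hl (adj s.inl) (adj s.inr))).trans (adj_adj _)
  · refine adj_inj ?_
    rw [adj_adj]
    refine BinaryFan.IsLimit.hom_ext hl ?_ ?_
    · refine Eq.trans ?_ (BinaryFan.IsLimit.lift_fst hl (adj s.inl) (adj s.inr)).symm
      have e := congrArg adj e₁
      rwa [adj_comp, adj_adj] at e
    · refine Eq.trans ?_ (BinaryFan.IsLimit.lift_snd hl (adj s.inl) (adj s.inr)).symm
      have e := congrArg adj e₂
      rwa [adj_comp, adj_adj] at e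

end Basic

section PreHilbert

attribute [local instance] HasZeroObject.zeroMorphismsOfZeroObject

/-- A pre-Hilbert `*`-category: a `*`-category with a zero object, binary orthonormal products and
isometric kernels, in which every diagonal `⟨1, 1⟩ : X ⟶ X ⊕ X` is a kernel. -/
class PreHilbertStarCategory (C : Type u) [Category.{v} C] [StarCategory C] : Prop
    extends HasZeroObject C where
  exists_orthonormalProduct : ∀ X₁ X₂ : C,
    ∃ (X : C) (r₁ : X ⟶ X₁) (r₂ : X ⟶ X₂), IsOrthonormalProduct r₁ r₂
  exists_isometric_kernel : ∀ {X Y : C} (f : X ⟶ Y),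
    ∃ (K : C) (k : K ⟶ X) (hk : k ≫ f = 0),
      IsIsometry k ∧ Nonempty (IsLimit (KernelFork.ofι k hk))
  diagonal_isKernel : ∀ {X P : C} (r₁ r₂ : P ⟶ X), IsOrthonormalProduct r₁ r₂ →
    ∀ d : X ⟶ P, d ≫ r₁ = 𝟙 X → d ≫ r₂ = 𝟙 X → Nonempty (NormalMono d)

variable {C : Type u} [Category.{v} C] [StarCategory C] [PreHilbertStarCategory C]

theorem hasBinaryBiproducts : HasBinaryBiproducts C :=
  ⟨fun X Y => by
    obtain ⟨_, _, _, h⟩ := PreHilbertStarCategory.exists_orthonormalProduct X Y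
    exact h.hasBinaryBiproduct⟩

attribute [local instance] hasBinaryBiproducts

/-- The canonical addition of parallel morphisms, induced by the binary biproducts. -/
noncomputable def add {X Y : C} (f g : X ⟶ Y) : X ⟶ Y :=
  biprod.lift f g ≫ biprod.desc (𝟙 Y) (𝟙 Y)

/-- The canonical order on Hermitian endomorphisms: `a ≤ b` if and only if `b - a = h* h`, that is,
`b = a + h* h`, for some morphism `h` out of `A`. -/
def HermLE {A : C} (a b : A ⟶ A) : Prop :=
  ∃ (X : C) (h : A ⟶ X), b = add a (sq h)

/-- `f` is a contraction if `f* f ≤ 1`. -/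
def IsContraction {X Y : C} (f : X ⟶ Y) : Prop := HermLE (sq f) (𝟙 X)

/-- `s` is the supremum of the family `a`. -/
def IsSupremum {A : C} {J : Type w} (a : J → (A ⟶ A)) (s : A ⟶ A) : Prop :=
  (∀ j, HermLE (a j) s) ∧ ∀ b : A ⟶ A, (∀ j, HermLE (a j) b) → HermLE s b

/-- A cone `(g_j)` is an `ℓ²`-cone if the family `(g_j* g_j)` is bounded above. A codirected
diagram indexed by the directed set `J` is a functor `F : Jᵒᵖ ⥤ C`. -/
def IsL2Cone {J : Type w} [Preorder J] {F : Jᵒᵖ ⥤ C} (g : Cone F) : Prop :=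
  ∃ b : g.pt ⟶ g.pt, ∀ j : J, HermLE (sq (g.π.app (op j))) b

/-- An `ℓ²`-limit: an `ℓ²`-cone `f` such that every `ℓ²`-cone `g` factors uniquely through `f`, and
the unique mediating morphism `m` satisfies `m* m = sup_j g_j* g_j`. -/
structure IsL2Limit {J : Type w} [Preorder J] {F : Jᵒᵖ ⥤ C} (f : Cone F) : Prop where
  isL2Cone : IsL2Cone f
  existsUnique_lift : ∀ g : Cone F, IsL2Cone g →
    ∃! m : g.pt ⟶ f.pt, ∀ j : J, m ≫ f.π.app (op j) = g.π.app (op j)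
  isSupremum_lift : ∀ g : Cone F, IsL2Cone g → ∀ m : g.pt ⟶ f.pt,
    (∀ j : J, m ≫ f.π.app (op j) = g.π.app (op j)) →
      IsSupremum (fun j : J => sq (g.π.app (op j))) (sq m)

end PreHilbert

/-- A Hilbert `*`-category: a pre-Hilbert `*`-category that has `ℓ²`-limits of all codirected
diagrams of contractions. Directed sets are non-empty preordered sets in which every pair of
elements has an upper bound; they range over an arbitrary fixed universe `w`. -/
class HilbertStarCategory (C : Type u) [Category.{v} C] [StarCategory C] : Prop
    extends PreHilbertStarCategory C where
  exists_isL2Limit : ∀ (J : Type w) [Preorder J] [IsDirectedOrder J] [Nonempty J] (F : Jᵒᵖ ⥤ C),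
    (∀ (j k : J) (hjk : j ≤ k), IsContraction (F.map (homOfLE hjk).op)) →
      ∃ f : Cone F, IsL2Limit f

/-- A pre-Hilbert `*`-category is Douglian if `f* f = g* g` implies that `g = h f` for some `h`. -/
def IsDouglian (C : Type u) [Category.{v} C] [StarCategory C] [PreHilbertStarCategory C] : Prop :=
  ∀ {A X Y : C} (f : A ⟶ X) (g : A ⟶ Y), sq f = sq g → ∃ h : X ⟶ Y, g = f ≫ h

end StarCategory

/-! The morphism `f` is replaced by data depending only on `f* f`: a monomorphism `j : L ⟶ A` with
`j j* = f* f` through which `g*` factors for every `g` with `g* g = f* f` (`exists_mono_sq_adj_eq`).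
If `f* = j m` and `g* = j n`, cancelling `j` gives `j* = m f`, hence `g = n* j* = (n* m) f`.

The object `L` plays the role of the range of the square root of `f* f`. Put `ε_n = 1/(n+1)`. Each
`f* f + ε_n` is `w_n* w_n` with `w_n` invertible, and the inverses of these increase with `n`; `L`
is the `ℓ²`-limit of `A` under the corresponding inner products (`exists_seqLimit`). Then `f* f ≤ j
j* ≤ f* f + ε_n` for all `n`, and an Archimedean property, itself a consequence of `ℓ²`-limits
(`eq_zero_of_nsmul_sq_le`), forces equality. -/

namespace StarCategory

/-! ### The involution. -/

section Involution

variable {C : Type u} [Category.{v} C] [StarCategory C]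

theorem adj_injective {X Y : C} {f g : X ⟶ Y} (h : adj f = adj g) : f = g := by
  rw [← adj_adj f, h, adj_adj]

theorem adj_zero [HasZeroMorphisms C] (X Y : C) : adj (0 : X ⟶ Y) = 0 := by
  have e : (0 : X ⟶ Y) = (0 : X ⟶ Y) ≫ adj (0 : X ⟶ Y) ≫ (0 : X ⟶ Y) := by simp
  rw [e, adj_comp, adj_comp, adj_adj]
  simp

theorem sq_id (X : C) : sq (𝟙 X) = 𝟙 X := by
  rw [sq, adj_id, Category.comp_id]

theorem sq_comp {X Y Z : C} (f : X ⟶ Y) (g : Y ⟶ Z) : sq (f ≫ g) = f ≫ sq g ≫ adj f := by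
  simp only [sq, adj_comp, Category.assoc]

theorem sq_comp_of_isIsometry {X Y Z : C} (f : X ⟶ Y) {g : Y ⟶ Z} (hg : IsIsometry g) :
    sq (f ≫ g) = sq f := by
  rw [sq_comp, sq, hg, Category.id_comp, sq]

theorem IsIsometry.mono {X Y : C} {f : X ⟶ Y} (hf : IsIsometry f) : Mono f :=
  ⟨fun a b h => by
    have := congrArg (· ≫ adj f) h
    simpa only [Category.assoc, show f ≫ adj f = 𝟙 X from hf, Category.comp_id] using this⟩

theorem adj_inv_comp_adj {X Y : C} (f : X ⟶ Y) [IsIso f] : adj (inv f) ≫ adj f = 𝟙 X := by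
  rw [← adj_comp, IsIso.hom_inv_id, adj_id]

theorem adj_comp_adj_inv {X Y : C} (f : X ⟶ Y) [IsIso f] : adj f ≫ adj (inv f) = 𝟙 Y := by
  rw [← adj_comp, IsIso.inv_hom_id, adj_id]

theorem isIso_adj {X Y : C} (f : X ⟶ Y) [IsIso f] : IsIso (adj f) :=
  ⟨adj (inv f), adj_comp_adj_inv f, adj_inv_comp_adj f⟩

end Involution

/-! ### Additive inverses and invertibility of `1 + f* f`. -/

section Additive

attribute [local instance] HasZeroObject.zeroMorphismsOfZeroObject

variable {C : Type u} [Category.{v} C] [StarCategory C] [PreHilbertStarCategory C]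

attribute [local instance] hasBinaryBiproducts
attribute [local instance] SemiadditiveOfBinaryBiproducts.addCommMonoidHomOfHasBinaryBiproducts

open SemiadditiveOfBinaryBiproducts (add_comp comp_add add_eq_left_addition)

theorem add_eq {X Y : C} (f g : X ⟶ Y) : add f g = f + g := (add_eq_left_addition f g).symm

section OrthonormalProduct

variable {X₁ X₂ P : C} {r₁ : P ⟶ X₁} {r₂ : P ⟶ X₂} (h : IsOrthonormalProduct r₁ r₂)

include h

theorem IsOrthonormalProduct.hom_ext {T : C} {f g : T ⟶ P} (e₁ : f ≫ r₁ = g ≫ r₁)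
    (e₂ : f ≫ r₂ = g ≫ r₂) : f = g := by
  obtain ⟨hl⟩ := h.isProduct
  exact BinaryFan.IsLimit.hom_ext hl e₁ e₂

theorem IsOrthonormalProduct.orthogonal' : adj r₁ ≫ r₂ = 0 := by
  have e := congrArg adj h.orthogonal
  rwa [adj_comp, adj_adj, adj_zero] at e

theorem IsOrthonormalProduct.lift_fst {T : C} (f : T ⟶ X₁) (g : T ⟶ X₂) :
    (f ≫ adj r₁ + g ≫ adj r₂) ≫ r₁ = f := by
  rw [add_comp, Category.assoc, Category.assoc, h.orthogonal,
    show adj r₁ ≫ r₁ = 𝟙 _ from h.coisometry₁, comp_zero, Category.comp_id, add_zero]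

theorem IsOrthonormalProduct.lift_snd {T : C} (f : T ⟶ X₁) (g : T ⟶ X₂) :
    (f ≫ adj r₁ + g ≫ adj r₂) ≫ r₂ = g := by
  rw [add_comp, Category.assoc, Category.assoc, h.orthogonal',
    show adj r₂ ≫ r₂ = 𝟙 _ from h.coisometry₂, comp_zero, Category.comp_id, zero_add]

theorem IsOrthonormalProduct.lift_comp_desc {T S : C} (f : T ⟶ X₁) (g : T ⟶ X₂) (p : X₁ ⟶ S)
    (q : X₂ ⟶ S) : (f ≫ adj r₁ + g ≫ adj r₂) ≫ (r₁ ≫ p + r₂ ≫ q) = f ≫ p + g ≫ q := by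
  rw [comp_add, ← Category.assoc, h.lift_fst, ← Category.assoc, h.lift_snd]

end OrthonormalProduct

theorem adj_add {X Y : C} (f g : X ⟶ Y) : adj (f + g) = adj f + adj g := by
  obtain ⟨P, r₁, r₂, h⟩ := PreHilbertStarCategory.exists_orthonormalProduct Y Y
  have e : adj (r₁ ≫ 𝟙 Y + r₂ ≫ 𝟙 Y) = 𝟙 Y ≫ adj r₁ + 𝟙 Y ≫ adj r₂ := by
    refine h.hom_ext ?_ ?_
    · rw [h.lift_fst]
      refine adj_injective ?_
      rw [adj_comp, adj_adj, comp_add, ← Category.assoc, ← Category.assoc, h.orthogonal',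
        show adj r₁ ≫ r₁ = 𝟙 _ from h.coisometry₁]
      simp [adj_id]
    · rw [h.lift_snd]
      refine adj_injective ?_
      rw [adj_comp, adj_adj, comp_add, ← Category.assoc, ← Category.assoc, h.orthogonal,
        show adj r₂ ≫ r₂ = 𝟙 _ from h.coisometry₂]
      simp [adj_id]
  have e' := congrArg adj (h.lift_comp_desc f g (𝟙 Y) (𝟙 Y))
  rw [adj_comp, e, Category.comp_id, Category.comp_id] at e'
  rw [← e', add_comp, Category.assoc, Category.assoc, ← adj_comp, ← adj_comp, h.lift_fst,
    h.lift_snd, Category.id_comp, Category.id_comp]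

theorem exists_isometric_kernel {X Y : C} (f : X ⟶ Y) : ∃ (K : C) (k : K ⟶ X),
    k ≫ f = 0 ∧ IsIsometry k ∧ ∀ {T : C} (m : T ⟶ X), m ≫ f = 0 → ∃ l : T ⟶ K, l ≫ k = m := by
  obtain ⟨K, k, hk, hi, ⟨hl⟩⟩ := PreHilbertStarCategory.exists_isometric_kernel f
  refine ⟨K, k, hk, hi, fun m hm => ?_⟩
  obtain ⟨l, e⟩ := KernelFork.IsLimit.lift' hl m hm
  exact ⟨l, e⟩

theorem exists_diagonal_isKernel {X P : C} {r₁ r₂ : P ⟶ X} (h : IsOrthonormalProduct r₁ r₂)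
    {d : X ⟶ P} (h₁ : d ≫ r₁ = 𝟙 X) (h₂ : d ≫ r₂ = 𝟙 X) : ∃ (Z : C) (g : P ⟶ Z),
    d ≫ g = 0 ∧ ∀ {T : C} (m : T ⟶ P), m ≫ g = 0 → ∃ l : T ⟶ X, l ≫ d = m := by
  obtain ⟨⟨Z, g, hg, hl⟩⟩ := PreHilbertStarCategory.diagonal_isKernel r₁ r₂ h d h₁ h₂
  refine ⟨Z, g, hg, fun m hm => ?_⟩
  obtain ⟨l, e⟩ := KernelFork.IsLimit.lift' hl m hm
  exact ⟨l, e⟩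

/-- Such an `f` factors through the isometric kernel `k` of `f*`, while `k* f = 0`. -/
theorem eq_zero_of_sq_eq_zero {X Y : C} {f : X ⟶ Y} (hf : sq f = 0) : f = 0 := by
  obtain ⟨K, k, hk, hi, hl⟩ := exists_isometric_kernel (adj f)
  obtain ⟨m, hm⟩ := hl f hf
  have e := congrArg adj hk
  rw [adj_comp, adj_adj, adj_zero, ← hm, Category.assoc, show k ≫ adj k = 𝟙 _ from hi,
    Category.comp_id] at e
  rw [← hm, e, zero_comp]

/-- The difference of morphisms into `X`, in the form of two morphisms `a`, `b` such that
`a m + b n` vanishes exactly if `m = n`. -/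
theorem exists_difference (X : C) : ∃ (Z : C) (a b : X ⟶ Z),
    ∀ {T : C} (m n : T ⟶ X), m ≫ a + n ≫ b = 0 ↔ m = n := by
  obtain ⟨P, r₁, r₂, h⟩ := PreHilbertStarCategory.exists_orthonormalProduct X X
  have d₁ := h.lift_fst (𝟙 X) (𝟙 X)
  have d₂ := h.lift_snd (𝟙 X) (𝟙 X)
  obtain ⟨Z, g, hg, hl⟩ := exists_diagonal_isKernel h d₁ d₂
  refine ⟨Z, adj r₁ ≫ g, adj r₂ ≫ g, fun {T} m n => ?_⟩
  rw [← Category.assoc, ← Category.assoc, ← add_comp]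
  constructor
  · intro e
    obtain ⟨l, e'⟩ := hl _ e
    have e₁ := congrArg (· ≫ r₁) e'
    have e₂ := congrArg (· ≫ r₂) e'
    simp only [Category.assoc l, d₁, d₂, h.lift_fst, h.lift_snd] at e₁ e₂
    rw [← e₁, ← e₂]
  · rintro rfl
    have : m ≫ adj r₁ + m ≫ adj r₂ = m ≫ (𝟙 X ≫ adj r₁ + 𝟙 X ≫ adj r₂) := by
      rw [comp_add, Category.id_comp, Category.id_comp]
    rw [this, Category.assoc, hg, comp_zero]

theorem epi_of_forall_comp_eq_zero {X Y : C} (f : X ⟶ Y)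
    (hf : ∀ {Z : C} (g : Y ⟶ Z), f ≫ g = 0 → g = 0) : Epi f := by
  refine ⟨fun {Z} m n e => ?_⟩
  obtain ⟨W, a, b, hab⟩ := exists_difference Z
  rw [← hab]
  refine hf _ ?_
  rw [comp_add, ← Category.assoc, ← Category.assoc, hab, e]

/-- The graph `⟨1, f⟩` is itself a kernel, so it differs from an isometric kernel by an isomorphism
`u`; hence `u* u = ⟨1, f⟩* ⟨1, f⟩`. -/
theorem exists_isIso_sq_eq_id_add_sq {X Y : C} (f : X ⟶ Y) :
    ∃ (X' : C) (u : X ⟶ X'), IsIso u ∧ sq u = 𝟙 X + sq f := by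
  obtain ⟨P, r₁, r₂, h⟩ := PreHilbertStarCategory.exists_orthonormalProduct X Y
  obtain ⟨Z, a, b, hab⟩ := exists_difference Y
  obtain ⟨K, k, hk, hi, hl⟩ := exists_isometric_kernel (r₁ ≫ f ≫ a + r₂ ≫ b)
  obtain ⟨l, hl₀⟩ : ∃ l, l = 𝟙 X ≫ adj r₁ + f ≫ adj r₂ := ⟨_, rfl⟩
  have l₁ : l ≫ r₁ = 𝟙 X := by rw [hl₀, h.lift_fst]
  have l₂ : l ≫ r₂ = f := by rw [hl₀, h.lift_snd]
  have hz : l ≫ (r₁ ≫ f ≫ a + r₂ ≫ b) = 0 := by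
    rw [hl₀, h.lift_comp_desc, Category.id_comp, hab]
  obtain ⟨u, hu⟩ := hl _ hz
  have hm := hi.mono
  refine ⟨K, u, ⟨k ≫ r₁, ?_, ?_⟩, ?_⟩
  · rw [← Category.assoc, hu, l₁]
  · rw [comp_add, ← Category.assoc, ← Category.assoc, ← Category.assoc, hab] at hk
    rw [← cancel_mono k, Category.assoc, Category.assoc, hu, Category.id_comp]
    refine h.hom_ext ?_ ?_
    · rw [Category.assoc, Category.assoc, l₁, Category.comp_id]
    · rw [Category.assoc, Category.assoc, l₂, ← hk, Category.assoc]
  · rw [← sq_comp_of_isIsometry u hi, hu, hl₀]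
    conv_lhs => rw [sq, adj_add, adj_comp, adj_comp, adj_adj, adj_adj, h.lift_comp_desc]
    rw [adj_id, Category.comp_id, sq]

/-- The sum `X ⊕ X` splits orthogonally into the diagonal, with isometric form `k`, and its
complement `k'`. The off-diagonal entry of `k k* + k' k'* = 1` reads `v v* + (...) = 0` with `v`
invertible. -/
theorem exists_id_add_eq_zero (X : C) : ∃ n : X ⟶ X, 𝟙 X + n = 0 := by
  obtain ⟨P, r₁, r₂, h⟩ := PreHilbertStarCategory.exists_orthonormalProduct X X
  have d₁ := h.lift_fst (𝟙 X) (𝟙 X)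
  have d₂ := h.lift_snd (𝟙 X) (𝟙 X)
  generalize 𝟙 X ≫ adj r₁ + 𝟙 X ≫ adj r₂ = d at d₁ d₂
  obtain ⟨Z, g, hg, hgl⟩ := exists_diagonal_isKernel h d₁ d₂
  obtain ⟨K, k, hk, hi, hl⟩ := exists_isometric_kernel g
  obtain ⟨K', k', hk', hi', hl'⟩ := exists_isometric_kernel (adj d)
  obtain ⟨v, hv⟩ := hgl k hk
  obtain ⟨u, hu⟩ := hl d hg
  have hm := hi.mono
  have huv : u ≫ v = 𝟙 X := by
    rw [← Category.comp_id (u ≫ v), ← d₁, Category.assoc, ← Category.assoc v, hv,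
      ← Category.assoc, hu]
  obtain ⟨R, s₁, s₂, hR⟩ := PreHilbertStarCategory.exists_orthonormalProduct K K'
  have hkk : k' ≫ adj k = 0 := by
    rw [← hv, adj_comp, ← Category.assoc, hk', zero_comp]
  have hkk' : k ≫ adj k' = 0 := by
    have e := congrArg adj hkk
    rwa [adj_comp, adj_adj, adj_zero] at e
  set j := s₁ ≫ k + s₂ ≫ k' with hj
  have hadj : adj j = adj k ≫ adj s₁ + adj k' ≫ adj s₂ := by
    rw [hj, adj_add, adj_comp, adj_comp]
  have j₁ : adj s₁ ≫ j = k := by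
    rw [hj, comp_add, ← Category.assoc, ← Category.assoc, hR.orthogonal',
      show adj s₁ ≫ s₁ = 𝟙 _ from hR.coisometry₁, zero_comp, add_zero, Category.id_comp]
  have j₂ : adj s₂ ≫ j = k' := by
    rw [hj, comp_add, ← Category.assoc, ← Category.assoc, hR.orthogonal,
      show adj s₂ ≫ s₂ = 𝟙 _ from hR.coisometry₂, zero_comp, zero_add, Category.id_comp]
  have hjj : j ≫ adj j = 𝟙 R := by
    refine hR.hom_ext ?_ ?_
    · rw [Category.assoc, hadj, hR.lift_fst, hj, add_comp, Category.assoc, Category.assoc, hkk,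
        show k ≫ adj k = 𝟙 _ from hi]
      simp
    · rw [Category.assoc, hadj, hR.lift_snd, hj, add_comp, Category.assoc, Category.assoc, hkk',
        show k' ≫ adj k' = 𝟙 _ from hi']
      simp
  -- The isometry `j` is unitary once epi: a morphism vanishing on both `k` and `k'` has its adjoint
  -- in the kernel of `d*`, hence factoring through `k'`, and so is zero.
  have hepi : Epi j := by
    refine epi_of_forall_comp_eq_zero j fun {T} t ht => ?_
    have t₁ : k ≫ t = 0 := by rw [← j₁, Category.assoc, ht, comp_zero]
    have t₂ : k' ≫ t = 0 := by rw [← j₂, Category.assoc, ht, comp_zero]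
    have t₃ : adj t ≫ adj d = 0 := by
      rw [← adj_comp, ← hu, Category.assoc, t₁, comp_zero, adj_zero]
    obtain ⟨m, e⟩ := hl' _ t₃
    have t₄ := congrArg adj t₂
    rw [adj_comp, adj_zero, ← e, Category.assoc, show k' ≫ adj k' = 𝟙 _ from hi',
      Category.comp_id] at t₄
    refine adj_injective ?_
    rw [← e, t₄, zero_comp, adj_zero]
  have hjj' : adj j ≫ j = 𝟙 P := by
    rw [← cancel_epi j, ← Category.assoc, hjj, Category.id_comp, Category.comp_id]
  have hsum : adj k ≫ k + adj k' ≫ k' = 𝟙 P := by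
    rw [← hjj', hadj, hj, hR.lift_comp_desc]
  have k₁ : k ≫ r₁ = v := by rw [← hv, Category.assoc, d₁, Category.comp_id]
  have k₂ : k ≫ r₂ = v := by rw [← hv, Category.assoc, d₂, Category.comp_id]
  have hoff : adj v ≫ v + adj (k' ≫ r₁) ≫ k' ≫ r₂ = 0 := by
    have e : adj r₁ ≫ (adj k ≫ k + adj k' ≫ k') ≫ r₂ = 0 := by
      rw [hsum, Category.id_comp, h.orthogonal']
    nth_rewrite 1 [← k₁]
    rw [← k₂, ← e, add_comp, comp_add, adj_comp, adj_comp]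
    simp only [Category.assoc]
  refine ⟨(adj (k' ≫ r₁) ≫ k' ≫ r₂) ≫ u ≫ adj u, ?_⟩
  have e : (adj v ≫ v) ≫ u ≫ adj u = 𝟙 X := by
    have hvu : v ≫ u = 𝟙 K := by
      rw [← cancel_mono k, Category.assoc, hu, hv, Category.id_comp]
    rw [Category.assoc, ← Category.assoc v, hvu, Category.id_comp, ← adj_comp, huv, adj_id]
  rw [← e, ← add_comp, hoff, zero_comp]

theorem exists_sq_eq_sq_add_sq {A X Y : C} (f : A ⟶ X) (g : A ⟶ Y) :
    ∃ (P : C) (z : A ⟶ P) (r₁ : P ⟶ X) (r₂ : P ⟶ Y),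
      sq z = sq f + sq g ∧ z ≫ r₁ = f ∧ z ≫ r₂ = g ∧ IsCoisometry r₁ := by
  obtain ⟨P, r₁, r₂, h⟩ := PreHilbertStarCategory.exists_orthonormalProduct X Y
  refine ⟨P, f ≫ adj r₁ + g ≫ adj r₂, r₁, r₂, ?_, h.lift_fst f g, h.lift_snd f g, h.coisometry₁⟩
  conv_lhs => rw [sq, adj_add, adj_comp, adj_comp, adj_adj, adj_adj, h.lift_comp_desc]
  rfl

theorem eq_zero_of_sq_add_sq_eq_zero {A X Y : C} {f : A ⟶ X} {g : A ⟶ Y}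
    (h : sq f + sq g = 0) : f = 0 := by
  obtain ⟨P, z, r₁, r₂, hz, h₁, -, -⟩ := exists_sq_eq_sq_add_sq f g
  rw [← h₁, eq_zero_of_sq_eq_zero (hz.trans h), zero_comp]

/-- The additive inverse provided by `exists_id_add_eq_zero`. -/
noncomputable def negOne (X : C) : X ⟶ X := (exists_id_add_eq_zero X).choose

/-- A pre-Hilbert `*`-category is preadditive. -/
@[reducible]
noncomputable def preadditive : Preadditive C where
  homGroup X Y :=
    { SemiadditiveOfBinaryBiproducts.addCommMonoidHomOfHasBinaryBiproducts X Y with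
      neg := fun f => negOne X ≫ f
      zsmul := letI : Neg (X ⟶ Y) := ⟨fun f => negOne X ≫ f⟩; zsmulRec
      neg_add_cancel := fun f => by
        have e : negOne X ≫ f + 𝟙 X ≫ f = 0 := by
          rw [← add_comp, add_comm, negOne, (exists_id_add_eq_zero X).choose_spec, zero_comp]
        rwa [Category.id_comp] at e }
  add_comp _ _ _ := add_comp
  comp_add _ _ _ := comp_add

end Additive

end StarCategory
namespace StarCategory

/-! ### The order: contractions, inversion, multiples of the identity. -/

section Order

variable {C : Type u} [Category.{v} C] [StarCategory C] [PreHilbertStarCategory C]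

attribute [local instance] preadditive

theorem hermLE_iff {A : C} {a b : A ⟶ A} :
    HermLE a b ↔ ∃ (X : C) (h : A ⟶ X), b = a + sq h := by
  refine exists_congr fun X => exists_congr fun h => ?_
  rw [add_eq]

theorem HermLE.trans {A : C} {a b c : A ⟶ A} (h₁ : HermLE a b) (h₂ : HermLE b c) :
    HermLE a c := by
  rw [hermLE_iff] at *
  obtain ⟨X, f, rfl⟩ := h₁
  obtain ⟨Y, g, rfl⟩ := h₂
  obtain ⟨P, z, -, -, hz, -⟩ := exists_sq_eq_sq_add_sq f g
  exact ⟨P, z, by rw [add_assoc]; exact congrArg _ hz.symm⟩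

theorem HermLE.conj {A B : C} {a b : A ⟶ A} (h : HermLE a b) (f : B ⟶ A) :
    HermLE (f ≫ a ≫ adj f) (f ≫ b ≫ adj f) := by
  rw [hermLE_iff] at *
  obtain ⟨X, g, rfl⟩ := h
  exact ⟨X, f ≫ g, by rw [sq_comp, Preadditive.add_comp, Preadditive.comp_add]⟩

theorem sq_le_sq_comp {A B X Y : C} {f : A ⟶ X} {g : A ⟶ Y} (h : HermLE (sq f) (sq g))
    (k : B ⟶ A) : HermLE (sq (k ≫ f)) (sq (k ≫ g)) := by
  rw [sq_comp, sq_comp]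
  exact h.conj k

theorem IsContraction.sq_comp_le {X Y Z : C} {f : Y ⟶ Z} (hf : IsContraction f) (k : X ⟶ Y) :
    HermLE (sq (k ≫ f)) (sq k) := by
  have := sq_le_sq_comp (f := f) (g := 𝟙 Y) (by rwa [sq_id]) k
  rwa [Category.comp_id] at this

theorem isContraction_inv_comp {A X Y : C} {f : A ⟶ X} {g : A ⟶ Y} [IsIso g]
    (h : HermLE (sq f) (sq g)) : IsContraction (inv g ≫ f) := by
  have := sq_le_sq_comp h (inv g)
  rwa [IsIso.inv_hom_id, sq_id] at this

theorem adj_sub {X Y : C} (f g : X ⟶ Y) : adj (f - g) = adj f - adj g := by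
  rw [eq_sub_iff_add_eq]
  have := adj_add (f - g) g
  exact this.symm.trans (congrArg adj (sub_add_cancel f g))

/-- Dilation: if `t* t + h* h = 1`, then `z = ⟨t, h⟩` is an isometry with `t = r₁ z`, and `1 - t t*`
is the compression by `r₁` of the projection `1 - z z*`. -/
theorem IsContraction.adj {X Y : C} {t : X ⟶ Y} (ht : IsContraction t) :
    IsContraction (adj t) := by
  obtain ⟨Z, h, e⟩ := hermLE_iff.1 ht
  obtain ⟨P, z, r₁, r₂, hz, h₁, -, hr⟩ := exists_sq_eq_sq_add_sq t h
  have hz : z ≫ StarCategory.adj z = 𝟙 X := hz.trans e.symm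
  refine hermLE_iff.2 ⟨P, StarCategory.adj r₁ ≫ (𝟙 P - StarCategory.adj z ≫ z), ?_⟩
  have e₁ : sq (𝟙 P - StarCategory.adj z ≫ z) = 𝟙 P - StarCategory.adj z ≫ z := by
    rw [sq, adj_sub, adj_id, adj_comp, adj_adj, Preadditive.sub_comp, Preadditive.comp_sub,
      Preadditive.comp_sub]
    simp only [Category.assoc, Category.id_comp, Category.comp_id]
    rw [← Category.assoc z, hz, Category.id_comp]
    abel
  rw [sq_comp, e₁, adj_adj, Preadditive.sub_comp, Preadditive.comp_sub, Category.id_comp,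
    show StarCategory.adj r₁ ≫ r₁ = 𝟙 Y from hr, sq, adj_adj, ← h₁, adj_comp]
  simp only [Category.assoc]
  abel

/-- Inversion reverses the order. -/
theorem sq_adj_inv_le {A X Y : C} {f : A ⟶ X} {g : A ⟶ Y} [IsIso f] [IsIso g]
    (h : HermLE (sq f) (sq g)) : HermLE (sq (adj (inv g))) (sq (adj (inv f))) := by
  have := (isContraction_inv_comp h).adj.sq_comp_le (adj (inv f))
  rwa [adj_comp, ← Category.assoc, adj_inv_comp_adj, Category.id_comp] at this

theorem exists_isIso_sq_eq_sq_add_sq {A X Y : C} (e : A ⟶ X) [IsIso e] (f : A ⟶ Y) :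
    ∃ (W : C) (w : A ⟶ W), IsIso w ∧ sq w = sq e + sq f := by
  obtain ⟨W, u, hu, h⟩ := exists_isIso_sq_eq_id_add_sq (inv e ≫ f)
  -- The addition becomes that of `preadditive`, definitionally the biproduct one.
  have h : sq u = 𝟙 X + sq (inv e ≫ f) := h
  refine ⟨W, e ≫ u, inferInstance, ?_⟩
  rw [sq_comp, h, Preadditive.add_comp, Preadditive.comp_add, ← sq_comp, IsIso.hom_inv_id_assoc,
    Category.id_comp]
  rfl

theorem exists_isIso_sq_eq_nsmul (A : C) (n : ℕ) :
    ∃ (V : C) (v : A ⟶ V), IsIso v ∧ sq v = (n + 1) • 𝟙 A := by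
  induction n with
  | zero => exact ⟨A, 𝟙 A, inferInstance, by rw [sq_id]; simp⟩
  | succ n ih =>
    obtain ⟨V, v, hv, e⟩ := ih
    obtain ⟨W, w, hw, e'⟩ := exists_isIso_sq_eq_sq_add_sq v (𝟙 A)
    exact ⟨W, w, hw, by rw [e', e, sq_id, ← succ_nsmul]⟩

theorem sq_comp_eq_nsmul {A B V : C} {v : A ⟶ V} {n : ℕ} (hv : sq v = n • 𝟙 A) (f : B ⟶ A) :
    sq (f ≫ v) = n • sq f := by
  rw [sq_comp, hv, Preadditive.nsmul_comp, Preadditive.comp_nsmul, Category.id_comp, sq]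

theorem HermLE.nsmul {A : C} {a b : A ⟶ A} (h : HermLE a b) (n : ℕ) :
    HermLE ((n + 1) • a) ((n + 1) • b) := by
  rw [hermLE_iff] at *
  obtain ⟨X, f, rfl⟩ := h
  obtain ⟨V, v, -, hv⟩ := exists_isIso_sq_eq_nsmul X n
  exact ⟨V, f ≫ v, by rw [sq_comp_eq_nsmul hv, nsmul_add]⟩

theorem hermLE_nsmul_of_le (A : C) {m n : ℕ} (h : m ≤ n) :
    HermLE ((m + 1) • 𝟙 A) ((n + 1) • 𝟙 A) := by
  induction h with
  | refl => exact hermLE_iff.2 ⟨A, 0, by simp [sq]⟩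
  | step _ ih => exact ih.trans (hermLE_iff.2 ⟨A, 𝟙 A, by rw [sq_id, ← succ_nsmul]⟩)

theorem HermLE.add_left {A : C} {a b : A ⟶ A} (h : HermLE a b) (c : A ⟶ A) :
    HermLE (c + a) (c + b) := by
  rw [hermLE_iff] at *
  obtain ⟨X, f, rfl⟩ := h
  exact ⟨X, f, by rw [add_assoc]⟩

theorem HermLE.of_add_left {A : C} {a b c : A ⟶ A} (h : HermLE (c + a) (c + b)) :
    HermLE a b := by
  rw [hermLE_iff] at *
  obtain ⟨X, f, e⟩ := h
  exact ⟨X, f, by rwa [add_assoc, add_right_inj] at e⟩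

/-- A sequence of invertible positive endomorphisms of `A` decreasing to zero. -/
theorem exists_nsmul_sq_eq_id (A : C) : ∃ (E : ℕ → C) (e : ∀ n, A ⟶ E n),
    (∀ n, IsIso (e n)) ∧ (∀ n, (n + 1) • sq (e n) = 𝟙 A) ∧
      ∀ m n, m ≤ n → HermLE (sq (e n)) (sq (e m)) := by
  choose V v hi hv using exists_isIso_sq_eq_nsmul A
  refine ⟨V, fun n => adj (inv (v n)), fun n => isIso_adj _, fun n => ?_, fun m n h => ?_⟩
  · change (n + 1) • sq (adj (inv (v n))) = 𝟙 A
    rw [← Category.comp_id (sq (adj (inv (v n)))), ← Preadditive.comp_nsmul, ← hv, sq, sq, adj_adj,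
      Category.assoc, IsIso.inv_hom_id_assoc, adj_inv_comp_adj]
  · refine sq_adj_inv_le ?_
    rw [hv, hv]
    exact hermLE_nsmul_of_le A h

end Order

/-! ### Limits of increasing inner products, and the Archimedean property. -/

section Limit

variable {C : Type u} [Category.{v} C] [StarCategory C]

/-- The diagram of the objects `U n` with connecting morphisms `u m (u n)⁻¹`. -/
noncomputable def seqDiagram {A : C} {U : ℕ → C} (u : ∀ n, A ⟶ U n) [∀ n, IsIso (u n)] :
    (ULift.{w} ℕ)ᵒᵖ ⥤ C where
  obj x := U x.unop.down
  map {x y} _ := inv (u x.unop.down) ≫ u y.unop.down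

/-- The cone on `seqDiagram u` given by a morphism into `A`. -/
noncomputable def seqCone {A : C} {U : ℕ → C} (u : ∀ n, A ⟶ U n) [∀ n, IsIso (u n)] {B : C}
    (g : B ⟶ A) : Cone (seqDiagram.{w} u) where
  pt := B
  π := { app := fun x => g ≫ u x.unop.down
         naturality := fun x y f => by simp [seqDiagram] }

/-- The space of vectors of finite norm for an increasing sequence of inner products on `A`. -/
theorem exists_seqLimit [HilbertStarCategory.{w, v, u} C] {A : C} {U : ℕ → C}
    (u : ∀ n, A ⟶ U n) [∀ n, IsIso (u n)] (hu : ∀ m n, m ≤ n → HermLE (sq (u m)) (sq (u n))) :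
    ∃ (L : C) (j : L ⟶ A), Mono j ∧ (∀ n, IsContraction (j ≫ u n)) ∧
      ∀ {B : C} (g : B ⟶ A), (∃ b, ∀ n, HermLE (sq (g ≫ u n)) b) →
        ∃ m : B ⟶ L, m ≫ j = g ∧ IsSupremum (fun n => sq (g ≫ u n)) (sq m) := by
  have : IsDirectedOrder (ULift.{w} ℕ) :=
    ⟨fun a b => ⟨⟨max a.down b.down⟩, le_max_left a.down b.down, le_max_right a.down b.down⟩⟩
  obtain ⟨f, hf⟩ := HilbertStarCategory.exists_isL2Limit (ULift.{w} ℕ) (seqDiagram.{w} u)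
    fun j k hjk => show IsContraction (inv (u k.down) ≫ u j.down) from
      isContraction_inv_comp (hu j.down k.down hjk)
  obtain ⟨p, hp⟩ : ∃ p : ∀ n, f.pt ⟶ U n, ∀ n, f.π.app (op (ULift.up n)) = p n :=
    ⟨_, fun _ => rfl⟩
  have hc : ∀ n, IsContraction (p n) := fun n => by
    -- The limit cone factors through itself by `1`, so `1` is the supremum of its `p_n* p_n`.
    have := (hf.isSupremum_lift f hf.isL2Cone (𝟙 _) fun j => Category.id_comp _).1 ⟨n⟩
    rw [sq_id] at this
    rw [← hp]
    exact this
  obtain ⟨j, hj⟩ : ∃ j : f.pt ⟶ A, ∀ n, j ≫ u n = p n := by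
    refine ⟨p 0 ≫ inv (u 0), fun n => ?_⟩
    have e : p n ≫ inv (u n) ≫ u 0 = p 0 := by
      rw [← hp, ← hp]
      exact f.w (homOfLE (show ULift.up.{w} 0 ≤ ULift.up n from Nat.zero_le n)).op
    simp [← e]
  have lift {B : C} (g : B ⟶ A) (hg : ∃ b, ∀ n, HermLE (sq (g ≫ u n)) b) :
      (∃! m : B ⟶ f.pt, ∀ n, m ≫ p n = g ≫ u n) ∧
        ∀ m : B ⟶ f.pt, (∀ n, m ≫ p n = g ≫ u n) →
          IsSupremum (fun n => sq (g ≫ u n)) (sq m) := by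
    have hb : IsL2Cone (seqCone.{w} u g) := hg.imp fun b h n => h n.down
    have key (m : B ⟶ f.pt) : (∀ n : ULift.{w} ℕ, m ≫ f.π.app (op n) = g ≫ u n.down) ↔
        ∀ n, m ≫ p n = g ≫ u n := by
      simp only [← hp]
      exact ⟨fun h n => h ⟨n⟩, fun h n => h n.down⟩
    refine ⟨?_, fun m hm => ?_⟩
    · obtain ⟨m, hm, hm'⟩ := hf.existsUnique_lift _ hb
      exact ⟨m, (key m).1 hm, fun m' h => hm' m' ((key m').2 h)⟩
    · have hs := hf.isSupremum_lift _ hb m ((key m).2 hm)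
      exact ⟨fun n => hs.1 ⟨n⟩, fun b h => hs.2 b fun n => h n.down⟩
  refine ⟨f.pt, j, ⟨fun {B} a b e => ?_⟩, fun n => by rw [hj]; exact hc n, fun {B} g hg => ?_⟩
  · refine (lift (a ≫ j) ⟨sq a, fun n => ?_⟩).1.unique (fun n => ?_) (fun n => ?_)
    · rw [Category.assoc, hj]
      exact (hc n).sq_comp_le a
    · rw [Category.assoc, hj]
    · rw [e, Category.assoc, hj]
  · obtain ⟨h, hs⟩ := lift g hg
    obtain ⟨m, hm⟩ := h.exists
    refine ⟨m, ?_, hs m hm⟩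
    rw [← cancel_mono (u 0), Category.assoc, hj, hm]

attribute [local instance] preadditive

variable [HilbertStarCategory.{w, v, u} C]

/-- The multiples `(n + 1) e* e` have a supremum `m* m`; shifting the index shows that `m* m - e* e`
is also an upper bound, so `-e* e` is positive. -/
theorem eq_zero_of_nsmul_sq_le {A X : C} (e : A ⟶ X) {b : A ⟶ A}
    (h : ∀ n : ℕ, HermLE ((n + 1) • sq e) b) : e = 0 := by
  choose V v hi hv using exists_isIso_sq_eq_nsmul X
  obtain ⟨L, j, -, -, hl⟩ := exists_seqLimit.{w} v fun m n hmn => by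
    rw [hv, hv]
    exact hermLE_nsmul_of_le X hmn
  obtain ⟨m, -, hs⟩ := hl e ⟨b, fun n => by rw [sq_comp_eq_nsmul (hv n)]; exact h n⟩
  have hle : HermLE (sq m) (sq m - sq e) := by
    refine hs.2 _ fun n => HermLE.of_add_left (c := sq e) ?_
    have : HermLE (sq (e ≫ v (n + 1))) (sq m) := hs.1 (n + 1)
    change HermLE (sq e + sq (e ≫ v n)) _
    rw [sq_comp_eq_nsmul (hv _)] at this ⊢
    rwa [add_sub_cancel, ← succ_nsmul']
  obtain ⟨Y, k, hk⟩ := hermLE_iff.1 hle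
  refine eq_zero_of_sq_add_sq_eq_zero (g := k) ?_
  have : sq e + sq k = 0 := by
    rw [sub_eq_iff_eq_add, add_assoc, left_eq_add, add_comm] at hk
    exact hk
  exact this

theorem exists_mono_sq_adj_eq {A X : C} (f : A ⟶ X) : ∃ (L : C) (j : L ⟶ A), Mono j ∧
    sq (adj j) = sq f ∧ ∀ {Y : C} (g : A ⟶ Y), sq g = sq f → ∃ m : Y ⟶ L, m ≫ j = adj g := by
  obtain ⟨E, e, he, hn, ha⟩ := exists_nsmul_sq_eq_id A
  choose W w hw hs using fun n => exists_isIso_sq_eq_sq_add_sq (e n) f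
  have (n : ℕ) : IsIso (adj (inv (w n))) := isIso_adj _
  obtain ⟨L, j, hj, hc, hl⟩ := exists_seqLimit.{w} (fun n => adj (inv (w n)))
    (hu := fun m n hmn => by
      refine sq_adj_inv_le ?_
      rw [hs, hs, add_comm, add_comm _ (sq f)]
      exact (ha m n hmn).add_left _)
  have lift {Y : C} (g : A ⟶ Y) (hg : sq g = sq f) :
      ∃ m : Y ⟶ L, m ≫ j = adj g ∧ IsContraction m := by
    -- Since `g* g = f* f ≤ w_n* w_n`, the morphism `g w_n⁻¹` is a contraction, and so is its
    -- adjoint.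
    have hb : ∀ n, HermLE (sq (adj g ≫ adj (inv (w n)))) (𝟙 Y) := fun n => by
      rw [← adj_comp]
      refine (isContraction_inv_comp ?_).adj
      exact hermLE_iff.2 ⟨_, e n, by rw [hs, hg, add_comm]⟩
    obtain ⟨m, hm, hsup⟩ := hl (adj g) ⟨_, hb⟩
    exact ⟨m, hm, hsup.2 _ hb⟩
  refine ⟨L, j, hj, ?_, fun g hg => (lift g hg).imp fun m hm => hm.1⟩
  obtain ⟨m, hm, hmc⟩ := lift f rfl
  -- With `f* = j m` and `m` a contraction, `f* f = j m m* j* ≤ j j*`.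
  have h₁ : HermLE (sq f) (sq (adj j)) := by
    have := hmc.adj.sq_comp_le (adj j)
    rwa [← adj_comp, hm, adj_adj] at this
  have h₂ : ∀ n, HermLE (sq (adj j)) (sq (w n)) := fun n => by
    have := (hc n).adj.sq_comp_le (w n)
    rwa [adj_comp, adj_adj, IsIso.hom_inv_id_assoc] at this
  obtain ⟨Z, k, hk⟩ := hermLE_iff.1 h₁
  have hz : k = 0 := by
    -- The gap `k* k` lies below every `ε_n = e_n* e_n`, that is, `(n + 1) k* k ≤ 1`.
    refine eq_zero_of_nsmul_sq_le k (b := 𝟙 A) fun n => ?_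
    rw [← hn n]
    refine HermLE.nsmul (HermLE.of_add_left (c := sq f) ?_) n
    rw [← hk, add_comm, ← hs]
    exact h₂ n
  rw [hk, hz]
  simp [sq]

end Limit

end StarCategory

theorem mainTheorem4 {C : Type u} [Category.{v} C] [StarCategory C]
    [hC : StarCategory.HilbertStarCategory.{w, v, u} C] : StarCategory.IsDouglian C := by
  intro A X Y f g hfg
  obtain ⟨L, j, hj, hf, hl⟩ := StarCategory.exists_mono_sq_adj_eq.{w} f
  obtain ⟨m, hm⟩ := hl f rfl
  obtain ⟨n, hn⟩ := hl g hfg.symm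
  have e : f ≫ m = StarCategory.adj j := by
    rw [← cancel_mono j, Category.assoc, hm]
    refine hf.symm.trans ?_
    rw [StarCategory.sq, StarCategory.adj_adj]
  refine ⟨m ≫ StarCategory.adj n, ?_⟩
  rw [← Category.assoc, e, ← StarCategory.adj_comp, hn, StarCategory.adj_adj]
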